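/- Let $p$ be a prime, let $G$ be a finite $p$-group and let $A\le\operatorname{Aut}(G)$. Commutators $[x,y]=x^{-1}y^{-1}xy$ are formed in the semidirect product of $G$ by $A$, and $[x_1,\dots,x_m]=[[x_1,\dots,x_{m-1}],x_m]$, $[x_1]=x_1$. Let $\gamma_p(G,A)$ be the subgroup of $G$ generated by all left normed commutators $[x_1,\dots,x_m]$ with $m\ge p$, $x_1\in G$, all $x_i\in G\cup A$, and at least $p-1$ of the $x_i$ in $A$. Assume that $A$ acts $p$-centrally on $\gamma_p(G,A)$, that is, every element of $A$ fixes every element of $\gamma_p(G,A)$ of order dividing $p$ (of order dividing $4$ if $p=2$). Let $H=[G,A]$ be the subgroup of $G$ generated by the elements $g^{-1}\sigma(g)$ with $g\in G$, $\sigma\in A$, and for an integer $n\ge 0$ let $\Omega_n(H)$ be the subgroup generated by the elements of $H$ of order dividing $p^n$. Then for every $\sigma\in A$ and every integer $n\ge 0$, $\sigma^{p^n}=1$ if and only if $\sigma$ acts trivially on $G/\Omega_n(H)$, that is, $g^{-1}\sigma(g)\in\Omega_n(H)$ for all $g\in G$. -/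

import Mathlib

namespace PCentral

/-- The left normed commutator `[x, y₁, …, yₘ]` in a group, defined by `[x] = x` and
`[x, y₁, …, yₘ] = [[x, y₁, …, yₘ₋₁], yₘ]`, where `[c, y] = c⁻¹ y⁻¹ c y`. -/
def leftNormed {K : Type*} [Group K] (x : K) (l : List K) : K :=
  l.foldl (fun c y => c⁻¹ * y⁻¹ * c * y) x

section Action

variable {G A : Type*} [Group G] [Group A] (φ : A →* MulAut G)

/-- An element of `G` or of `A`, viewed in the semidirect product of `G` by `A`. -/
def letter : G ⊕ A → G ⋊[φ] A
  | Sum.inl g => SemidirectProduct.inl g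
  | Sum.inr a => SemidirectProduct.inr a

/-- `γ_k(G, A)`: the subgroup of `G` generated by all left normed commutators `[x₁, …, xₘ]`,
with `x₁` in `G`, the other `xᵢ` in `G ∪ A`, and at least `k - 1` of them in `A`
(hence `m ≥ k`). The commutators are formed in the semidirect product of `G` by `A`; they all lie
in `G`, because `x₁` does. -/
def gammaSeries (k : ℕ) : Subgroup G :=
  Subgroup.closure {g : G | ∃ (x : G) (l : List (G ⊕ A)),
    k ≤ l.countP (fun z => z.isRight) + 1 ∧
    (SemidirectProduct.inl g : G ⋊[φ] A) =
      leftNormed (SemidirectProduct.inl x) (l.map (letter φ))}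

/-- `[G, A]`: the subgroup of `G` generated by the elements `g⁻¹ gᵃ`, with `g ∈ G`, `a ∈ A`. -/
def actionCommutator : Subgroup G :=
  Subgroup.closure {x : G | ∃ (g : G) (a : A), x = g⁻¹ * φ a g}

/-- `A` acts `p`-centrally on the subgroup `S` of `G`: it fixes every element of `S` of order
dividing `p` (dividing `4` if `p = 2`). -/
def ActsPCentrally (p : ℕ) (S : Subgroup G) : Prop :=
  ∀ x ∈ S, x ^ (if p = 2 then 4 else p) = 1 → ∀ a : A, φ a x = x

end Action

section Omega

variable {G : Type*} [Group G]

/-- `Ω_n(H)`: the subgroup generated by the elements of `H` of order dividing `p ^ n`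
(regarded as a subgroup of `G`). -/
def omega (p n : ℕ) (H : Subgroup G) : Subgroup G :=
  Subgroup.closure {h : G | h ∈ H ∧ h ^ p ^ n = 1}

/-- The automorphism `σ` of `G` acts trivially on `G / N`: it maps every coset `g N` to itself. -/
def ActsTriviallyOnQuotient (σ : MulAut G) (N : Subgroup G) : Prop :=
  ∀ g : G, (QuotientGroup.mk (σ g) : G ⧸ N) = QuotientGroup.mk g

end Omega

end PCentral

/-!
Put `z = g⁻¹ σ(g)`. In the semidirect product `z σ` is conjugate to `σ`, so that `σ ^ p ^ n` fixes
`g` exactly when `(z σ) ^ p ^ n = σ ^ p ^ n`. It remains to compare this with `z ^ p ^ n = 1`.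

Inside `P = ⟨γ_2(G, A), σ⟩` the `i`-th term of the lower central series lies in `γ_{i+1}(G, A)` for
`i ≥ 2`, so that the elements of order dividing `p` (or `4`) in `γ_2(G, A) ∩ γ_{p-1}(P)` are central
in `P`. Let `p` be odd; for `p = 2` the relevant `z` are themselves central. If the commutator of
`z` and `x` lies in a normal subgroup of exponent `p`, the group generated by `z` and `x` therefore
has class less than `p` and commutators of order dividing `p`, and `(z x) ^ p = z ^ p x ^ p`.
Climbing the upper central series gives `(z x) ^ p = x ^ p ↔ z ^ p = 1`. For powers `p ^ n` one
passes to the quotient of `P` by the elements of order dividing `p` in `γ_2(G, A)`, where the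
centrality condition persists.
-/

namespace PCentral

open scoped commutatorElement

section PolynomialSequences

variable {L : Type*} [Group L]

/-- A descending chain of subgroups `F 0 ≥ F 1 ≥ ⋯` compatible with commutators, with respect to
which the weights of polynomial sequences are measured. -/
structure IsCommFiltration (F : ℕ → Subgroup L) : Prop where
  antitone : Antitone F
  commutator_le : ∀ i j, ⁅F i, F j⁆ ≤ F (i + j)

/-- The multiplicative forward difference of a sequence in a group, with the increment on the
left. -/
def mulDiff (f : ℕ → L) : ℕ → L := fun m => f (m + 1) * (f m)⁻¹

theorem mulDiff_pow_choose_zero (c : L) :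
    mulDiff (fun m => c ^ m.choose 0) = fun m => (1 : L) ^ m.choose 0 := by
  funext m
  simp [mulDiff]

theorem mulDiff_pow_choose_succ (c : L) (j : ℕ) :
    mulDiff (fun m => c ^ m.choose (j + 1)) = fun m => c ^ m.choose j := by
  funext m
  simp [mulDiff, Nat.choose_succ_succ, pow_add]

theorem mulDiff_mul (f g : ℕ → L) : mulDiff (f * g) = mulDiff f * (f * mulDiff g * f⁻¹) := by
  funext m
  simp [mulDiff, mul_assoc]

theorem mulDiff_inv (f : ℕ → L) : mulDiff f⁻¹ = f⁻¹ * (mulDiff f)⁻¹ * f⁻¹⁻¹ := by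
  funext m
  simp [mulDiff]

/-- On the right every factor is a commutator of sequences at least one of which is a difference,
up to conjugation: this is what puts the difference of a commutator one weight higher. -/
theorem mulDiff_commutator (f g : ℕ → L) :
    mulDiff ⁅f, g⁆ =
      (mulDiff f * ⁅f, mulDiff g⁆ * (mulDiff f)⁻¹) *
        (mulDiff f * ⁅mulDiff g, ⁅f, g⁆⁆ * (mulDiff f)⁻¹) * ⁅mulDiff f, ⁅f, g⁆⁆ *
        (⁅f, g⁆ * (⁅mulDiff f, mulDiff g⁆ * (mulDiff g * ⁅mulDiff f, g⁆ * (mulDiff g)⁻¹)) *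
          ⁅f, g⁆⁻¹) := by
  funext m
  simp [mulDiff, commutatorElement_def, mul_assoc]

/-- Polynomial sequences of weight `k` with respect to a filtration `F`. Lazard and Leibman define
them by requiring the `j`-th differences to take values in `F (k + j)`, and then have to prove that
products and commutators of polynomial sequences are polynomial. Here the closure properties are
built in, and the statement about differences becomes the theorem. -/
inductive PolySeq (F : ℕ → Subgroup L) : ℕ → (ℕ → L) → Prop
  | pow_choose (k j : ℕ) (c : L) (hc : c ∈ F (k + j)) : PolySeq F k (fun m => c ^ m.choose j)
  | mul {k : ℕ} {f g : ℕ → L} (hf : PolySeq F k f) (hg : PolySeq F k g) : PolySeq F k (f * g)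
  | inv {k : ℕ} {f : ℕ → L} (hf : PolySeq F k f) : PolySeq F k f⁻¹
  | commutator {k l : ℕ} {f g : ℕ → L} (hf : PolySeq F k f) (hg : PolySeq F l g) :
      PolySeq F (k + l) ⁅f, g⁆
  | of_succ {k : ℕ} {f : ℕ → L} (hf : PolySeq F (k + 1) f) : PolySeq F k f

namespace PolySeq

variable {F : ℕ → Subgroup L} {k l : ℕ} {f g : ℕ → L}

theorem of_le (hkl : k ≤ l) (hf : PolySeq F l f) : PolySeq F k f := by
  induction l, hkl using Nat.le_induction with
  | base => exact hf
  | succ l _ ih => exact ih hf.of_succ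

theorem conj (hf : PolySeq F k f) (hg : PolySeq F l g) : PolySeq F l (f * g * f⁻¹) := by
  have h : f * g * f⁻¹ = ⁅f, g⁆ * g := by simp [commutatorElement_def]
  rw [h]
  exact ((hf.commutator hg).of_le (Nat.le_add_left l k)).mul hg

theorem diff (hf : PolySeq F k f) : PolySeq F (k + 1) (mulDiff f) := by
  induction hf with
  | pow_choose k j c hc =>
    cases j with
    | zero =>
      rw [mulDiff_pow_choose_zero]
      exact pow_choose _ _ _ (one_mem _)
    | succ j =>
      rw [mulDiff_pow_choose_succ]
      exact pow_choose _ _ _ (by rwa [add_assoc, add_comm 1 j])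
  | mul hf _ ihf ihg =>
    rw [mulDiff_mul]
    exact ihf.mul (hf.conj ihg)
  | inv hf ih =>
    rw [mulDiff_inv]
    exact hf.inv.conj ih.inv
  | commutator hf hg ihf ihg =>
    have hfg := hf.commutator hg
    rw [mulDiff_commutator]
    refine ((PolySeq.mul ?_ ?_).mul ?_).mul (hfg.conj (PolySeq.mul ?_ ?_))
    · exact ihf.conj ((hf.commutator ihg).of_le (by lia))
    · exact ihf.conj ((ihg.commutator hfg).of_le (by lia))
    · exact (ihf.commutator hfg).of_le (by lia)
    · exact (ihf.commutator ihg).of_le (by lia)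
    · exact ihg.conj ((ihf.commutator hg).of_le (by lia))
  | of_succ _ ih => exact ih.of_succ

theorem apply_mem (hF : IsCommFiltration F) (hf : PolySeq F k f) (m : ℕ) : f m ∈ F k := by
  induction hf with
  | pow_choose k j c hc => exact pow_mem (hF.antitone (Nat.le_add_right k j) hc) _
  | mul _ _ ihf ihg => exact mul_mem ihf ihg
  | inv _ ih => exact inv_mem ih
  | commutator _ _ ihf ihg =>
    exact hF.commutator_le _ _ (Subgroup.commutator_mem_commutator ihf ihg)
  | of_succ _ ih => exact hF.antitone (Nat.le_succ _) ih

theorem apply_mem_of_forall_lt (hF : IsCommFiltration F) (hf : PolySeq F k f) {n : ℕ}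
    (h : ∀ i < n, f i = 1) : f n ∈ F (k + n) := by
  induction n generalizing k f with
  | zero => exact hf.apply_mem hF 0
  | succ n ih =>
    have hn := ih hf.diff fun i hi => by simp [mulDiff, h i (by lia), h (i + 1) (by lia)]
    rw [mulDiff, h n (by lia), inv_one, mul_one] at hn
    rwa [show k + (n + 1) = k + 1 + n by lia]

/-- As long as `f` vanishes on `0, …, n - 1`, dividing it by `m ↦ (f n) ^ (m choose n)` makes it
vanish at `n` too, without changing `f p`, because `p` divides `p choose n`. -/
theorem apply_prime_eq_one (hF : IsCommFiltration F) {p : ℕ} (hp : p.Prime) (hbot : F p = ⊥)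
    {n : ℕ} (hn : 0 < n) (hnp : n ≤ p) (hexp : ∀ c ∈ F n, c ^ p = 1) (hf : PolySeq F 0 f)
    (h : ∀ i < n, f i = 1) : f p = 1 := by
  induction hd : p - n generalizing n f with
  | zero =>
    obtain rfl : n = p := by lia
    simpa [hbot] using hf.apply_mem_of_forall_lt hF h
  | succ d ih =>
    have hfn : f n ∈ F (0 + n) := hf.apply_mem_of_forall_lt hF h
    have hn_mem : f n ∈ F n := by rwa [zero_add] at hfn
    have hg := ih (n := n + 1) (by lia) (by lia)
      (fun c hc => hexp c (hF.antitone n.le_succ hc)) ((pow_choose 0 n (f n) hfn).inv.mul hf)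
      (fun i hi => ?_) (by lia)
    · obtain ⟨e, he⟩ := hp.dvd_choose_self hn.ne' (by lia)
      simpa [he, pow_mul, hexp _ hn_mem] using hg
    · rcases Nat.lt_succ_iff_lt_or_eq.mp hi with hi | rfl
      · simp [h i hi, Nat.choose_eq_zero_of_lt hi]
      · simp

end PolySeq

end PolynomialSequences

section Commutators

variable {L : Type*} [Group L]

theorem le_iff_map_mk'_eq_bot {N K : Subgroup L} [N.Normal] :
    K ≤ N ↔ K.map (QuotientGroup.mk' N) = ⊥ := by
  rw [Subgroup.map_eq_bot_iff, QuotientGroup.ker_mk']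

theorem commutator_closure_le {S T : Set L} {N : Subgroup L} [N.Normal]
    (h : ∀ s ∈ S, ∀ t ∈ T, ⁅s, t⁆ ∈ N) :
    ⁅Subgroup.closure S, Subgroup.closure T⁆ ≤ N := by
  rw [le_iff_map_mk'_eq_bot, Subgroup.map_commutator, MonoidHom.map_closure,
    MonoidHom.map_closure, Subgroup.commutator_eq_bot_iff_le_centralizer,
    Subgroup.centralizer_closure, Subgroup.closure_le]
  rintro _ ⟨s, hs, rfl⟩
  rw [SetLike.mem_coe, Subgroup.mem_centralizer_iff_commutator_eq_one]
  rintro _ ⟨t, ht, rfl⟩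
  rw [← map_commutatorElement, QuotientGroup.mk'_apply, QuotientGroup.eq_one_iff,
    ← commutatorElement_inv]
  exact inv_mem (h s hs t ht)

theorem commutator_normalClosure_le {S T : Set L} {N : Subgroup L} [N.Normal]
    (hS : ∀ s ∈ S, ∀ g : L, g * s * g⁻¹ ∈ S) (h : ∀ s ∈ S, ∀ t ∈ T, ⁅s, t⁆ ∈ N) :
    ⁅Subgroup.closure S, Subgroup.normalClosure T⁆ ≤ N := by
  refine commutator_closure_le fun s hs u hu => ?_
  obtain ⟨t, ht, htu⟩ := Group.mem_conjugatesOfSet_iff.mp hu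
  obtain ⟨g, rfl⟩ := isConj_iff.mp htu
  have hconj := Subgroup.Normal.conj_mem ‹_› _ (h _ (hS s hs g⁻¹) t ht) g
  rw [conjugate_commutatorElement] at hconj
  simpa [mul_assoc] using hconj

theorem commutator_commutator_le_of_rotate {H₁ H₂ H₃ N : Subgroup L} [N.Normal]
    (h₁ : ⁅⁅H₂, H₃⁆, H₁⁆ ≤ N) (h₂ : ⁅⁅H₃, H₁⁆, H₂⁆ ≤ N) : ⁅⁅H₁, H₂⁆, H₃⁆ ≤ N := by
  simp only [le_iff_map_mk'_eq_bot, Subgroup.map_commutator] at h₁ h₂ ⊢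
  exact Subgroup.commutator_commutator_eq_bot_of_rotate h₁ h₂

theorem commutator_top_lowerCentralSeries_le (i j : ℕ) :
    ⁅(⊤ : Subgroup L).lowerCentralSeries i, (⊤ : Subgroup L).lowerCentralSeries j⁆ ≤
      (⊤ : Subgroup L).lowerCentralSeries (i + j + 1) := by
  induction i generalizing j with
  | zero => rw [Nat.zero_add, Subgroup.commutator_comm]; exact le_rfl
  | succ i ih =>
    refine commutator_commutator_le_of_rotate ?_ ?_
    · rw [Subgroup.commutator_comm ⊤, Subgroup.commutator_comm]
      exact (ih (j + 1)).trans_eq (by congr 1; lia)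
    · rw [Subgroup.commutator_comm (Subgroup.lowerCentralSeries ⊤ j)]
      exact (Subgroup.commutator_mono (ih j) le_rfl).trans_eq (by
        rw [← Subgroup.lowerCentralSeries_succ]; congr 1; lia)

theorem commutator_lowerCentralSeries_le (R : Subgroup L) (i j : ℕ) :
    ⁅R.lowerCentralSeries i, R.lowerCentralSeries j⁆ ≤ R.lowerCentralSeries (i + j + 1) := by
  simp only [← Subgroup.top_subtype_lowerCentralSeries R, ← Subgroup.map_commutator]
  exact Subgroup.map_mono (commutator_top_lowerCentralSeries_le i j)

/-- In class less than `p`, the defect `(z * x) ^ m * x⁻¹ ^ m * z⁻¹ ^ m` is a polynomial sequence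
vanishing at `0` and `1`, so that it also vanishes at `p`. -/
theorem mul_pow_prime_of_lowerCentralSeries_eq_bot {p : ℕ} (hp : p.Prime) {R : Subgroup L}
    (hbot : R.lowerCentralSeries (p - 1) = ⊥) (hexp : ∀ c ∈ ⁅R, R⁆, c ^ p = 1) {z x : L}
    (hz : z ∈ R) (hx : x ∈ R) : (z * x) ^ p = z ^ p * x ^ p := by
  have hF : IsCommFiltration fun i => R.lowerCentralSeries (i - 1) :=
    { antitone := fun i j hij => Subgroup.lowerCentralSeries_antitone _ (by lia)
      commutator_le := fun i j => (commutator_lowerCentralSeries_le R _ _).trans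
        (Subgroup.lowerCentralSeries_antitone _ (by lia)) }
  have hpow {c : L} (hc : c ∈ R) :
      PolySeq (fun i => R.lowerCentralSeries (i - 1)) 0 (fun m => c ^ m.choose 1) :=
    .pow_choose 0 1 c hc
  have h := PolySeq.apply_prime_eq_one hF hp hbot two_pos hp.two_le hexp
    ((hpow (mul_mem hz hx)).mul ((hpow hx).inv.mul (hpow hz).inv)) fun i hi => by
      interval_cases i <;> simp
  simp only [Pi.mul_apply, Pi.inv_apply, Nat.choose_one_right] at h
  rwa [← mul_inv_rev, mul_inv_eq_one] at h

end Commutators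

section Torsion

variable {P : Type*} [Group P]

theorem closure_normal_of_conj_mem {S : Set P} (hS : ∀ s ∈ S, ∀ g : P, g * s * g⁻¹ ∈ S) :
    (Subgroup.closure S).Normal := by
  refine ⟨fun x hx g => ?_⟩
  have hle : Subgroup.closure S ≤ (Subgroup.closure S).comap (MulAut.conj g).toMonoidHom :=
    (Subgroup.closure_le _).mpr fun s hs => Subgroup.subset_closure (hS s hs g)
  exact hle hx

instance omega_normal (p n : ℕ) (H : Subgroup P) [H.Normal] : (omega p n H).Normal :=
  closure_normal_of_conj_mem fun h hh g =>
    ⟨Subgroup.Normal.conj_mem ‹_› h hh.1 g, by rw [conj_pow, hh.2, mul_one, mul_inv_cancel]⟩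

theorem mem_omega_iff {p n : ℕ} {H : Subgroup P}
    (hmul : ∀ a ∈ H, a ^ p ^ n = 1 → ∀ b ∈ H, (a * b) ^ p ^ n = b ^ p ^ n) {x : P} :
    x ∈ omega p n H ↔ x ∈ H ∧ x ^ p ^ n = 1 := by
  refine ⟨fun hx => ?_, fun hx => Subgroup.subset_closure hx⟩
  induction hx using Subgroup.closure_induction with
  | mem _ hx => exact hx
  | one => exact ⟨one_mem _, one_pow _⟩
  | mul x y _ _ hx hy => exact ⟨mul_mem hx.1 hy.1, by rw [hmul x hx.1 hx.2 y hy.1, hy.2]⟩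
  | inv x _ hx => exact ⟨inv_mem hx.1, by rw [inv_pow, hx.2, inv_one]⟩

theorem mem_omega_one_iff {p : ℕ} {H : Subgroup P}
    (hmul : ∀ a ∈ H, a ^ p = 1 → ∀ b ∈ H, (a * b) ^ p = b ^ p) {x : P} :
    x ∈ omega p 1 H ↔ x ∈ H ∧ x ^ p = 1 := by
  simpa only [pow_one] using mem_omega_iff (n := 1) (by simpa only [pow_one] using hmul)

theorem commutatorElement_mul_conj_pow {z x : P} {m : ℕ} (h : Commute (z ^ m) x) :
    (⁅z, x⁆ * (x * z * x⁻¹)) ^ m = (x * z * x⁻¹) ^ m := by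
  have hz : ⁅z, x⁆ * (x * z * x⁻¹) = z := by simp [commutatorElement_def, mul_assoc]
  rw [hz, conj_pow, ← h.eq, mul_inv_cancel_right]

theorem commutatorElement_mul_pow {z x : P} {m : ℕ} (h : Commute z (x ^ m)) :
    (⁅z, x⁆ * x) ^ m = x ^ m := by
  rw [commutatorElement_def, inv_mul_cancel_right, conj_pow, h.eq, mul_inv_cancel_right]

theorem commute_pow_of_mul_pow_eq {z x : P} {m : ℕ} (h : (z * x) ^ m = x ^ m) :
    Commute z (x ^ m) := by
  have hzx : Commute (z * x) (x ^ m) := h ▸ Commute.self_pow (z * x) m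
  simpa using hzx.mul_left (Commute.self_pow x m).inv_left

theorem commutatorElement_eq_sq_of_mul_sq_eq {z x : P} (h : (z * x) ^ 2 = x ^ 2) :
    ⁅z, x⁆ = z ^ 2 := by
  have hzxz : z * x * z = x := by
    rw [sq, sq, ← mul_assoc] at h
    exact mul_right_cancel h
  have hinv : x * z⁻¹ * x⁻¹ = z := by
    rw [mul_inv_eq_iff_eq_mul, mul_inv_eq_iff_eq_mul, hzxz]
  rw [commutatorElement_def, mul_assoc, mul_assoc, ← mul_assoc x, hinv, sq]

end Torsion

section Conjugation

variable {p n : ℕ} {P : Type*} [Group P] {Q N E : Subgroup P} {x z : P}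

/-- `P` acts `p`-centrally, by conjugation, on the part of `Q` lying in the lower central term
`γ_{p-1}(P)`, which Mathlib numbers `p - 2`. For `Q = γ_2(G, A)` that part lies in `γ_p(G, A)`. -/
def IsPCentralIn (p : ℕ) (Q : Subgroup P) : Prop :=
  ActsPCentrally MulAut.conj p (Q ⊓ (⊤ : Subgroup P).lowerCentralSeries (p - 2))

namespace IsPCentralIn

theorem commute (hQ : IsPCentralIn p Q) (hz : z ∈ Q)
    (hz_lcs : z ∈ (⊤ : Subgroup P).lowerCentralSeries (p - 2))
    (hzp : z ^ (if p = 2 then 4 else p) = 1) (x : P) : Commute z x :=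
  .symm (mul_inv_eq_iff_eq_mul.mp (hQ z ⟨hz, hz_lcs⟩ hzp x))

theorem commute_of_two (hQ : IsPCentralIn 2 Q) (hz : z ∈ Q) (hz4 : z ^ 4 = 1) (x : P) :
    Commute z x :=
  hQ.commute hz (Subgroup.mem_top z) hz4 x

theorem subgroupOf (hQ : IsPCentralIn p Q) (R : Subgroup P) : IsPCentralIn p (Q.subgroupOf R) := by
  rintro z ⟨hz, hz_lcs⟩ hzp x
  refine Subtype.ext (hQ z ⟨hz, ?_⟩ (congrArg Subtype.val hzp) x)
  have hmap := Subgroup.mem_map_of_mem R.subtype hz_lcs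
  rw [Subgroup.top_subtype_lowerCentralSeries] at hmap
  exact Subgroup.lowerCentralSeries_mono _ le_top hmap

theorem mul_pow_prime_of_commutator_mem (hQ : IsPCentralIn p Q) (hp : p.Prime) (hp2 : p ≠ 2)
    [E.Normal] (hEQ : E ≤ Q) (hE : ∀ c ∈ E, c ^ p = 1) (hzx : ⁅z, x⁆ ∈ E) :
    (z * x) ^ p = z ^ p * x ^ p := by
  set R := Subgroup.closure {z, x}
  have hR : ⁅R, R⁆ ≤ E := by
    have hxz : ⁅x, z⁆ ∈ E := commutatorElement_inv z x ▸ inv_mem hzx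
    refine commutator_closure_le ?_
    rintro _ (rfl | rfl) _ (rfl | rfl) <;> simp [hzx, hxz]
  refine mul_pow_prime_of_lowerCentralSeries_eq_bot hp ?_ (fun c hc => hE c (hR hc))
    (Subgroup.subset_closure (.inl rfl)) (Subgroup.subset_closure (.inr rfl))
  have h2p := hp.two_le
  rw [show p - 1 = p - 2 + 1 by lia, Subgroup.lowerCentralSeries_succ,
    Subgroup.commutator_eq_bot_iff_le_centralizer]
  intro c hc
  have hcE : c ∈ E := hR (Subgroup.lowerCentralSeries_antitone R (by lia : 1 ≤ p - 2) hc)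
  exact Subgroup.mem_centralizer_iff.mpr fun g _ =>
    (hQ.commute (hEQ hcE) (Subgroup.lowerCentralSeries_mono _ le_top hc)
      (by simpa [hp2] using hE c hcE) g).symm

theorem mul_pow_prime_of_commutator_mem_of_iff (hQ : IsPCentralIn p Q) (hp : p.Prime) [N.Normal]
    (hNQ : N ≤ Q) (hN : ∀ a ∈ N, ∀ b, (a * b) ^ p = b ^ p ↔ a ^ p = 1) (hz : z ∈ Q)
    (hzx : ⁅z, x⁆ ∈ N)
    (h : z ^ p = 1 ∨ (z * x) ^ p = x ^ p) : (z * x) ^ p = z ^ p * x ^ p := by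
  have hcp : ⁅z, x⁆ ^ p = 1 := by
    rcases h with hzp | hzxp
    · exact (hN _ hzx _).mp (commutatorElement_mul_conj_pow (hzp ▸ Commute.one_left x))
    · exact (hN _ hzx _).mp (commutatorElement_mul_pow (commute_pow_of_mul_pow_eq hzxp))
  rcases eq_or_ne p 2 with rfl | hp2
  · have hz4 : (z ^ 2) ^ 2 = 1 := by
      rcases h with hz2 | hzx2
      · rw [hz2, one_pow]
      · rwa [← commutatorElement_eq_sq_of_mul_sq_eq hzx2]
    exact (hQ.commute_of_two hz (by rwa [← pow_mul] at hz4) x).mul_pow 2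
  · have hmem {y : P} : y ∈ omega p 1 N ↔ y ∈ N ∧ y ^ p = 1 :=
      mem_omega_one_iff fun a ha hap b _ => (hN a ha b).mpr hap
    exact hQ.mul_pow_prime_of_commutator_mem hp hp2 (fun c hc => hNQ (hmem.mp hc).1)
      (fun c hc => (hmem.mp hc).2) (hmem.mpr ⟨hzx, hcp⟩)

theorem mul_pow_prime_eq_iff (hQ : IsPCentralIn p Q) (hp : p.Prime) [Group.IsNilpotent P]
    [Q.Normal] (hz : z ∈ Q) (x : P) : (z * x) ^ p = x ^ p ↔ z ^ p = 1 := by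
  suffices h : ∀ i, ∀ z ∈ Q ⊓ Subgroup.upperCentralSeries P i, ∀ x : P,
      (z * x) ^ p = x ^ p ↔ z ^ p = 1 from
    h (Group.nilpotencyClass P) z (by simpa using hz) x
  intro i
  induction i with
  | zero =>
    rintro z ⟨-, hz⟩ x
    obtain rfl : z = 1 := hz
    simp
  | succ i ih =>
    rintro z ⟨hz, hz_succ⟩ x
    have hzx : ⁅z, x⁆ ∈ Q ⊓ Subgroup.upperCentralSeries P i :=
      ⟨(Subgroup.commutator_le_left Q ⊤) (Subgroup.commutator_mem_commutator hz trivial),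
        Subgroup.mem_upperCentralSeries_succ_iff.mp hz_succ x⟩
    have hmul := hQ.mul_pow_prime_of_commutator_mem_of_iff hp inf_le_left ih hz hzx
    exact ⟨fun h => by rwa [hmul (.inr h), mul_eq_right] at h,
      fun h => by rw [hmul (.inl h), h, one_mul]⟩

theorem mul_pow_prime_eq_of_mem (hQ : IsPCentralIn p Q) (hp : p.Prime) [Group.IsNilpotent Q]
    (hz : z ∈ Q) (hx : x ∈ Q) (hzp : z ^ p = 1) : (z * x) ^ p = x ^ p := by
  have hQQ : IsPCentralIn p (⊤ : Subgroup Q) := by simpa using hQ.subgroupOf Q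
  simpa [Subtype.ext_iff, hzp] using hQQ.mul_pow_prime_eq_iff hp (z := ⟨z, hz⟩) trivial ⟨x, hx⟩

theorem mem_omega_one_iff (hQ : IsPCentralIn p Q) (hp : p.Prime) [Group.IsNilpotent Q] :
    x ∈ omega p 1 Q ↔ x ∈ Q ∧ x ^ p = 1 :=
  PCentral.mem_omega_one_iff fun _ ha hap _ hb => hQ.mul_pow_prime_eq_of_mem hp ha hb hap

theorem omega_one_le (hQ : IsPCentralIn p Q) (hp : p.Prime) [Group.IsNilpotent Q] :
    omega p 1 Q ≤ Q :=
  fun _ hx => ((hQ.mem_omega_one_iff hp).mp hx).1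

theorem mul_pow_prime_eq (hQ : IsPCentralIn p Q) (hp : p.Prime) [Q.Normal] [Group.IsNilpotent Q]
    (hz : z ∈ omega p 1 Q) (x : P) : (z * x) ^ p = x ^ p := by
  obtain ⟨hzQ, hzp⟩ := (hQ.mem_omega_one_iff hp).mp hz
  suffices h : (z * x) ^ p = z ^ p * x ^ p by rw [h, hzp, one_mul]
  rcases eq_or_ne p 2 with rfl | hp2
  · have hz4 : z ^ 4 = 1 := by rw [show 4 = 2 * 2 from rfl, pow_mul, hzp, one_pow]
    exact (hQ.commute_of_two hzQ hz4 x).mul_pow 2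
  · exact hQ.mul_pow_prime_of_commutator_mem hp hp2 (hQ.omega_one_le hp)
      (fun c hc => ((hQ.mem_omega_one_iff hp).mp hc).2)
      (Subgroup.commutator_le_left _ ⊤ (Subgroup.commutator_mem_commutator hz trivial))

theorem commutator_mem_omega_one (hQ : IsPCentralIn p Q) (hp : p.Prime) [Q.Normal]
    [Group.IsNilpotent Q] (hz : z ∈ Q) (hzp : Commute (z ^ p) x) : ⁅z, x⁆ ∈ omega p 1 Q := by
  have hQQ : IsPCentralIn p (⊤ : Subgroup Q) := by simpa using hQ.subgroupOf Q
  have hzx : ⁅z, x⁆ ∈ Q :=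
    Subgroup.commutator_le_left Q ⊤ (Subgroup.commutator_mem_commutator hz trivial)
  have hconj : x * z * x⁻¹ ∈ Q := Subgroup.Normal.conj_mem ‹_› z hz x
  refine (hQ.mem_omega_one_iff hp).mpr ⟨hzx, ?_⟩
  simpa [Subtype.ext_iff] using (hQQ.mul_pow_prime_eq_iff hp (z := ⟨_, hzx⟩) trivial
    ⟨_, hconj⟩).mp (Subtype.ext (commutatorElement_mul_conj_pow hzp))

theorem quotient (hQ : IsPCentralIn p Q) (hp : p.Prime) [Q.Normal] [Group.IsNilpotent Q] :
    IsPCentralIn p (Q.map (QuotientGroup.mk' (omega p 1 Q))) := by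
  rintro _ ⟨hzQ, hz_lcs⟩ hzp g
  rw [← Subgroup.map_top_of_surjective _ (QuotientGroup.mk'_surjective (omega p 1 Q)),
    ← Subgroup.map_lowerCentralSeries] at hz_lcs
  obtain ⟨z, hz_lcs, rfl⟩ := hz_lcs
  obtain ⟨x, rfl⟩ := QuotientGroup.mk'_surjective _ g
  have hz : z ∈ Q := by
    rw [← Subgroup.comap_map_eq_self (f := QuotientGroup.mk' (omega p 1 Q)) (H := Q)]
    · exact hzQ
    · rw [QuotientGroup.ker_mk']
      exact hQ.omega_one_le hp
  rw [← map_pow, QuotientGroup.mk'_apply, QuotientGroup.eq_one_iff, hQ.mem_omega_one_iff hp,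
    pow_right_comm] at hzp
  have hcomm : ⁅z, x⁆ ∈ omega p 1 Q := hQ.commutator_mem_omega_one hp hz
    (hQ.commute (pow_mem hz p) (pow_mem hz_lcs p) hzp.2 x)
  rw [← QuotientGroup.eq_one_iff, ← QuotientGroup.mk'_apply, map_commutatorElement,
    commutatorElement_eq_one_iff_commute] at hcomm
  exact mul_inv_eq_iff_eq_mul.mpr hcomm.symm.eq

theorem mul_pow_prime_pow_eq (hQ : IsPCentralIn p Q) (hp : p.Prime) [Q.Normal]
    [Group.IsNilpotent Q] (hz : z ∈ Q) (hzp : z ^ p ^ n = 1) (x : P) :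
    (z * x) ^ p ^ n = x ^ p ^ n := by
  induction n generalizing P with
  | zero => simp_all
  | succ n ih =>
    let π := QuotientGroup.mk' (omega p 1 Q)
    have : (Q.map π).Normal := .map ‹_› _ (QuotientGroup.mk'_surjective _)
    have : Group.IsNilpotent (Q.map π) :=
      Group.nilpotent_of_surjective _ (π.subgroupMap_surjective Q)
    have hzE : z ^ p ^ n ∈ omega p 1 Q := (hQ.mem_omega_one_iff hp).mpr
      ⟨pow_mem hz _, by rw [← pow_mul, ← pow_succ, hzp]⟩
    have hq : π ((z * x) ^ p ^ n) = π (x ^ p ^ n) := by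
      simp only [map_pow, map_mul]
      exact ih (hQ.quotient hp) (Subgroup.mem_map_of_mem π hz)
        (by rw [← map_pow]; exact (QuotientGroup.eq_one_iff _).mpr hzE) (π x)
    have h := hQ.mul_pow_prime_eq hp (QuotientGroup.eq_iff_div_mem.mp hq) (x ^ p ^ n)
    rwa [div_mul_cancel, ← pow_mul, ← pow_mul, ← pow_succ] at h

theorem pow_prime_pow_eq_one (hQ : IsPCentralIn p Q) (hp : p.Prime) [Group.IsNilpotent P]
    [Q.Normal] (hz : z ∈ Q) (hzx : (z * x) ^ p ^ n = x ^ p ^ n) : z ^ p ^ n = 1 := by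
  induction n generalizing P with
  | zero => simpa using hzx
  | succ n ih =>
    let π := QuotientGroup.mk' (omega p 1 Q)
    have : (Q.map π).Normal := .map ‹_› _ (QuotientGroup.mk'_surjective _)
    have hdQ : (z * x) ^ p ^ n / x ^ p ^ n ∈ Q := by
      rw [← QuotientGroup.eq_iff_div_mem]
      simp [(QuotientGroup.eq_one_iff z).mpr hz]
    have hdE : (z * x) ^ p ^ n / x ^ p ^ n ∈ omega p 1 Q := by
      refine (hQ.mem_omega_one_iff hp).mpr
        ⟨hdQ, (hQ.mul_pow_prime_eq_iff hp hdQ (x ^ p ^ n)).mp ?_⟩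
      rw [div_mul_cancel, ← pow_mul, ← pow_mul, ← pow_succ, hzx]
    have hzE : π z ^ p ^ n = 1 := ih (hQ.quotient hp) (Subgroup.mem_map_of_mem π hz) (x := π x) (by
      rw [← map_mul, ← map_pow, ← map_pow]
      exact QuotientGroup.eq_iff_div_mem.mpr hdE)
    rw [← map_pow] at hzE
    rw [pow_succ, pow_mul]
    exact ((hQ.mem_omega_one_iff hp).mp ((QuotientGroup.eq_one_iff _).mp hzE)).2

end IsPCentralIn

end Conjugation

section LeftNormed

variable {K : Type*} [Group K]

theorem leftNormed_append_singleton (x : K) (l : List K) (y : K) :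
    leftNormed x (l ++ [y]) = (leftNormed x l)⁻¹ * y⁻¹ * leftNormed x l * y := by
  simp [leftNormed]

theorem leftNormed_mem_of_mem_cons {N : Subgroup K} [N.Normal] {x y : K} {l : List K}
    (hy : y ∈ x :: l) (hyN : y ∈ N) : leftNormed x l ∈ N := by
  induction l using List.reverseRecOn with
  | nil => simpa [leftNormed, List.mem_singleton.mp hy] using hyN
  | append_singleton l z ih =>
    rw [leftNormed_append_singleton]
    rw [← List.cons_append, List.mem_append, List.mem_singleton] at hy
    rcases hy with hy | rfl
    · have hl := ih hy
      simpa [mul_assoc] using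
        mul_mem (inv_mem hl) (Subgroup.Normal.conj_mem ‹_› _ hl z⁻¹)
    · exact mul_mem (by simpa using Subgroup.Normal.conj_mem ‹_› _ (inv_mem hyN) (leftNormed x l)⁻¹)
        hyN

end LeftNormed

section Semidirect

variable {G A : Type*} [Group G] [Group A] (φ : A →* MulAut G) {p n k : ℕ}

/-- `γ_k(G, A)` as a subgroup of the semidirect product of `G` by `A`. -/
def gammaSemidirect (k : ℕ) : Subgroup (G ⋊[φ] A) :=
  (gammaSeries φ k).map SemidirectProduct.inl

theorem gammaSemidirect_eq_closure (k : ℕ) :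
    gammaSemidirect φ k = Subgroup.closure {w | ∃ (x : G) (l : List (G ⊕ A)),
      k ≤ l.countP (fun z => z.isRight) + 1 ∧
      w = leftNormed (SemidirectProduct.inl x) (l.map (letter φ))} := by
  rw [gammaSemidirect, gammaSeries, MonoidHom.map_closure]
  congr 1
  ext w
  constructor
  · rintro ⟨g, ⟨x, l, hl, hg⟩, rfl⟩
    exact ⟨x, l, hl, hg⟩
  · rintro ⟨x, l, hl, rfl⟩
    have hker : leftNormed (SemidirectProduct.inl x) (l.map (letter φ)) ∈
        (SemidirectProduct.rightHom : G ⋊[φ] A →* A).ker :=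
      leftNormed_mem_of_mem_cons List.mem_cons_self (by simp)
    rw [← SemidirectProduct.range_inl_eq_ker_rightHom] at hker
    obtain ⟨g, hg⟩ := hker
    exact ⟨g, ⟨x, l, hl, hg⟩, hg⟩

theorem leftNormed_mem_gammaSemidirect (x : G) {l : List (G ⊕ A)}
    (hl : k ≤ l.countP (fun z => z.isRight) + 1) :
    leftNormed (SemidirectProduct.inl x) (l.map (letter φ)) ∈ gammaSemidirect φ k := by
  rw [gammaSemidirect_eq_closure]
  exact Subgroup.subset_closure ⟨x, l, hl, rfl⟩

theorem conj_letter_mem_gammaSemidirect (y : G ⊕ A) {w : G ⋊[φ] A}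
    (hw : w ∈ gammaSemidirect φ k) : (letter φ y)⁻¹ * w * letter φ y ∈ gammaSemidirect φ k := by
  suffices h : gammaSemidirect φ k ≤
      (gammaSemidirect φ k).comap (MulAut.conj (letter φ y)⁻¹).toMonoidHom by
    simpa using h hw
  conv_lhs => rw [gammaSemidirect_eq_closure]
  rw [Subgroup.closure_le]
  rintro _ ⟨x, l, hl, rfl⟩
  have hl_append : k ≤ (l ++ [y]).countP (fun z => z.isRight) + 1 := by
    rw [List.countP_append]; lia
  have hmul := mul_mem (leftNormed_mem_gammaSemidirect φ x hl)
    (leftNormed_mem_gammaSemidirect φ x hl_append)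
  rw [List.map_append, List.map_singleton, leftNormed_append_singleton] at hmul
  simpa [mul_assoc] using hmul

instance gammaSemidirect_normal (k : ℕ) : (gammaSemidirect φ k).Normal := by
  refine ⟨fun w hw u => ?_⟩
  have hright := conj_letter_mem_gammaSemidirect φ (Sum.inr u.right⁻¹) hw
  have hleft := conj_letter_mem_gammaSemidirect φ (Sum.inl u.left⁻¹) hright
  have hu : SemidirectProduct.inl u.left * SemidirectProduct.inr u.right = u :=
    SemidirectProduct.inl_left_mul_inr_right u
  rw [← hu, mul_inv_rev]
  simpa only [letter, map_inv, inv_inv, mul_assoc] using hleft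

/-- The normal closure of `A` in the semidirect product of `G` by `A`. -/
def actorClosure : Subgroup (G ⋊[φ] A) :=
  Subgroup.normalClosure (Set.range SemidirectProduct.inr)

theorem inr_mem_actorClosure (a : A) : SemidirectProduct.inr a ∈ actorClosure φ :=
  Subgroup.subset_normalClosure ⟨a, rfl⟩

theorem gammaSemidirect_two_le_actorClosure : gammaSemidirect φ 2 ≤ actorClosure φ := by
  have : (actorClosure φ).Normal := Subgroup.normalClosure_normal
  rw [gammaSemidirect_eq_closure, Subgroup.closure_le]
  rintro _ ⟨x, l, hl, rfl⟩
  obtain ⟨_ | a, hal, ha⟩ := List.countP_pos_iff.mp (show 0 < l.countP (fun z => z.isRight) by lia)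
  · simp at ha
  · exact leftNormed_mem_of_mem_cons (List.mem_cons_of_mem _ (List.mem_map_of_mem hal))
      (inr_mem_actorClosure φ a)

theorem commutator_inr_mem_gammaSemidirect (a : A) {w : G ⋊[φ] A} (hw : w ∈ gammaSemidirect φ k) :
    ⁅w, SemidirectProduct.inr a⁆ ∈ gammaSemidirect φ (k + 1) := by
  suffices h : ⁅gammaSemidirect φ k, Subgroup.closure {SemidirectProduct.inr a}⁆ ≤
      gammaSemidirect φ (k + 1) from
    h (Subgroup.commutator_mem_commutator hw (Subgroup.mem_closure_singleton_self _))
  rw [gammaSemidirect_eq_closure φ k]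
  refine commutator_closure_le ?_
  rintro _ ⟨x, l, hl, rfl⟩ _ rfl
  have hmem := leftNormed_mem_gammaSemidirect φ (k := k + 1) x (l := l ++ [Sum.inr a])
    (by simpa [List.countP_append] using hl)
  rw [List.map_append, List.map_singleton, leftNormed_append_singleton] at hmem
  have hconj := Subgroup.Normal.conj_mem inferInstance _ hmem
    (letter φ (Sum.inr a) * leftNormed (SemidirectProduct.inl x) (l.map (letter φ)))
  simpa [letter, commutatorElement_def, mul_assoc] using hconj

theorem commutator_gammaSemidirect_le (k : ℕ) :
    ⁅gammaSemidirect φ k, actorClosure φ⁆ ≤ gammaSemidirect φ (k + 1) := by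
  rw [← Subgroup.closure_eq (gammaSemidirect φ k)]
  refine commutator_normalClosure_le ?_ ?_
  · exact fun w hw g => Subgroup.Normal.conj_mem inferInstance w hw g
  · rintro w hw _ ⟨a, rfl⟩
    exact commutator_inr_mem_gammaSemidirect φ a hw

theorem commute_of_mem_actorClosure (hA : ActsPCentrally φ p (gammaSeries φ p)) {w u : G ⋊[φ] A}
    (hw : w ∈ gammaSemidirect φ p) (hwp : w ^ (if p = 2 then 4 else p) = 1)
    (hu : u ∈ actorClosure φ) : Commute w u := by
  rw [← commutatorElement_eq_one_iff_commute, ← Subgroup.mem_bot]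
  refine commutator_normalClosure_le
    (S := {w | w ∈ gammaSemidirect φ p ∧ w ^ (if p = 2 then 4 else p) = 1}) ?_ ?_
    (Subgroup.commutator_mem_commutator (Subgroup.subset_closure ⟨hw, hwp⟩) hu)
  · rintro w ⟨hw, hwp⟩ g
    exact ⟨Subgroup.Normal.conj_mem inferInstance w hw g, by
      rw [conj_pow, hwp, mul_one, mul_inv_cancel]⟩
  · rintro _ ⟨⟨g, hg, rfl⟩, hgp⟩ _ ⟨a, rfl⟩
    rw [← map_pow, ← map_one SemidirectProduct.inl, SemidirectProduct.inl_inj] at hgp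
    have hconj := SemidirectProduct.inl_aut (φ := φ) a g
    rw [hA g hg hgp a, map_inv, eq_mul_inv_iff_mul_eq] at hconj
    rw [Subgroup.mem_bot, commutatorElement_eq_one_iff_mul_comm, hconj]

theorem inl_mem_gammaSemidirect_two {h : G} (hh : h ∈ actionCommutator φ) :
    SemidirectProduct.inl h ∈ gammaSemidirect φ 2 := by
  suffices hle : actionCommutator φ ≤ gammaSeries φ 2 from Subgroup.mem_map_of_mem _ (hle hh)
  refine Subgroup.closure_mono ?_
  rintro _ ⟨g, a, rfl⟩
  exact ⟨g, [Sum.inr a⁻¹], by simp, by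
    simp [leftNormed, letter, SemidirectProduct.inl_aut, mul_assoc]⟩

/-- The subgroup of the semidirect product of `G` by `A` generated by `γ_2(G, A)` and `a`. -/
def actorExtension (a : A) : Subgroup (G ⋊[φ] A) :=
  gammaSemidirect φ 2 ⊔ Subgroup.zpowers (SemidirectProduct.inr a)

theorem inr_mem_actorExtension (a : A) : SemidirectProduct.inr a ∈ actorExtension φ a :=
  Subgroup.mem_sup_right (Subgroup.mem_zpowers _)

theorem actorExtension_le (a : A) : actorExtension φ a ≤ actorClosure φ :=
  sup_le (gammaSemidirect_two_le_actorClosure φ)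
    (Subgroup.zpowers_le.mpr (inr_mem_actorClosure φ a))

theorem lowerCentralSeries_actorExtension_le (a : A) (i : ℕ) :
    (actorExtension φ a).lowerCentralSeries (i + 1) ≤ gammaSemidirect φ (i + 3) := by
  induction i with
  | zero =>
    rw [Subgroup.lowerCentralSeries_succ, Subgroup.lowerCentralSeries_zero, actorExtension,
      ← Subgroup.closure_eq (gammaSemidirect φ 2), Subgroup.zpowers_eq_closure,
      ← Subgroup.closure_union]
    refine commutator_closure_le ?_
    have hcomm {q u : G ⋊[φ] A} (hq : q ∈ gammaSemidirect φ 2) (hu : u ∈ actorClosure φ) :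
        ⁅q, u⁆ ∈ gammaSemidirect φ 3 :=
      commutator_gammaSemidirect_le φ 2 (Subgroup.commutator_mem_commutator hq hu)
    rintro q (hq | rfl) r (hr | rfl)
    · exact hcomm hq (gammaSemidirect_two_le_actorClosure φ hr)
    · exact hcomm hq (inr_mem_actorClosure φ a)
    · rw [← commutatorElement_inv]
      exact inv_mem (hcomm hr (inr_mem_actorClosure φ a))
    · rw [commutatorElement_self]
      exact one_mem _
  | succ i ih =>
    rw [Subgroup.lowerCentralSeries_succ]
    exact (Subgroup.commutator_mono ih (actorExtension_le φ a)).trans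
      (commutator_gammaSemidirect_le φ _)

theorem gammaSemidirect_two_inf_lowerCentralSeries_le (a : A) (i : ℕ) :
    gammaSemidirect φ 2 ⊓ (actorExtension φ a).lowerCentralSeries i ≤
      gammaSemidirect φ (i + 2) := by
  cases i with
  | zero => exact inf_le_left
  | succ i => exact inf_le_right.trans (lowerCentralSeries_actorExtension_le φ a i)

theorem isPCentralIn_actorExtension (hp : p.Prime) (hA : ActsPCentrally φ p (gammaSeries φ p))
    (a : A) : IsPCentralIn p ((gammaSemidirect φ 2).subgroupOf (actorExtension φ a)) := by
  rintro w ⟨hw, hw_lcs⟩ hwp u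
  have hmap := Subgroup.mem_map_of_mem (actorExtension φ a).subtype hw_lcs
  rw [Subgroup.top_subtype_lowerCentralSeries] at hmap
  have hwγ : (w : G ⋊[φ] A) ∈ gammaSemidirect φ p := by
    have h := gammaSemidirect_two_inf_lowerCentralSeries_le φ a (p - 2) ⟨hw, hmap⟩
    rwa [Nat.sub_add_cancel hp.two_le] at h
  have hcomm := commute_of_mem_actorClosure φ hA hwγ (congrArg Subtype.val hwp)
    (actorExtension_le φ a u.2)
  exact Subtype.ext (mul_inv_eq_iff_eq_mul.mpr hcomm.eq.symm)

theorem isPGroup_gammaSemidirect (hG : IsPGroup p G) (k : ℕ) : IsPGroup p (gammaSemidirect φ k) :=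
  (hG.to_subgroup _).map _

theorem isPGroup_actorExtension (hG : IsPGroup p G) {a : A} (ha : a ^ p ^ n = 1) :
    IsPGroup p (actorExtension φ a) := by
  refine (isPGroup_gammaSemidirect φ hG 2).to_sup_of_normal_left ?_
  rintro ⟨_, i, rfl⟩
  refine ⟨n, Subtype.ext ?_⟩
  change ((SemidirectProduct.inr a : G ⋊[φ] A) ^ i) ^ p ^ n = 1
  rw [← zpow_natCast, zpow_comm, zpow_natCast, ← map_pow, ha, map_one, one_zpow]

theorem inl_mul_inr_pow_eq_iff (a : A) (g : G) (m : ℕ) :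
    (SemidirectProduct.inl (g⁻¹ * φ a g) * SemidirectProduct.inr a : G ⋊[φ] A) ^ m =
      SemidirectProduct.inr a ^ m ↔ φ (a ^ m) g = g := by
  have hconj : (SemidirectProduct.inl (g⁻¹ * φ a g) * SemidirectProduct.inr a : G ⋊[φ] A) =
      SemidirectProduct.inl g⁻¹ * SemidirectProduct.inr a * (SemidirectProduct.inl g⁻¹)⁻¹ := by
    simp [SemidirectProduct.inl_aut, mul_assoc]
  have haut : (SemidirectProduct.inl (φ (a ^ m) g) : G ⋊[φ] A) =
      SemidirectProduct.inr a ^ m * SemidirectProduct.inl g * (SemidirectProduct.inr a ^ m)⁻¹ := by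
    rw [SemidirectProduct.inl_aut, map_inv, map_pow]
  rw [hconj, conj_pow, ← SemidirectProduct.inl_inj (φ := φ), haut, map_inv, inv_inv,
    mul_inv_eq_iff_eq_mul, mul_assoc, inv_mul_eq_iff_eq_mul]

variable [Finite G]

theorem isNilpotent_gammaSemidirect (hp : p.Prime) (hG : IsPGroup p G) (k : ℕ) :
    Group.IsNilpotent (gammaSemidirect φ k) := by
  have : Fact p.Prime := ⟨hp⟩
  have : Group.IsNilpotent (gammaSeries φ k) := (hG.to_subgroup _).isNilpotent
  exact Group.nilpotent_of_surjective _ (MonoidHom.subgroupMap_surjective _ (gammaSeries φ k))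

theorem mul_pow_prime_pow_eq_of_mem_actorExtension (hp : p.Prime) (hG : IsPGroup p G)
    (hA : ActsPCentrally φ p (gammaSeries φ p)) {a : A} {z x : G ⋊[φ] A}
    (hz : z ∈ gammaSemidirect φ 2) (hx : x ∈ actorExtension φ a) (hzp : z ^ p ^ n = 1) :
    (z * x) ^ p ^ n = x ^ p ^ n := by
  have := isNilpotent_gammaSemidirect φ hp hG 2
  have : Group.IsNilpotent ((gammaSemidirect φ 2).subgroupOf (actorExtension φ a)) :=
    Group.nilpotent_of_mulEquiv (Subgroup.subgroupOfEquivOfLe le_sup_left).symm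
  exact congrArg Subtype.val ((isPCentralIn_actorExtension φ hp hA a).mul_pow_prime_pow_eq hp
    (z := ⟨z, Subgroup.mem_sup_left hz⟩) hz (Subtype.ext hzp) ⟨x, hx⟩)

theorem mem_omega_actionCommutator_iff (hp : p.Prime) (hG : IsPGroup p G)
    (hA : ActsPCentrally φ p (gammaSeries φ p)) {x : G} :
    x ∈ omega p n (actionCommutator φ) ↔ x ∈ actionCommutator φ ∧ x ^ p ^ n = 1 := by
  refine mem_omega_iff fun a ha hap b hb => SemidirectProduct.inl_injective (φ := φ) ?_
  simp only [map_pow, map_mul]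
  refine mul_pow_prime_pow_eq_of_mem_actorExtension φ hp hG hA (a := 1)
    (inl_mem_gammaSemidirect_two φ ha)
    (Subgroup.mem_sup_left (inl_mem_gammaSemidirect_two φ hb)) ?_
  rw [← map_pow, hap, map_one]

instance finite_semidirectProduct [Finite A] : Finite (G ⋊[φ] A) :=
  .of_equiv _ SemidirectProduct.equivProd.symm

theorem pow_prime_pow_eq_one_of_mem_actorExtension [Finite A] (hp : p.Prime) (hG : IsPGroup p G)
    (hA : ActsPCentrally φ p (gammaSeries φ p)) {a : A} (ha : a ^ p ^ n = 1) {z x : G ⋊[φ] A}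
    (hz : z ∈ gammaSemidirect φ 2) (hx : x ∈ actorExtension φ a)
    (hzx : (z * x) ^ p ^ n = x ^ p ^ n) : z ^ p ^ n = 1 := by
  have : Fact p.Prime := ⟨hp⟩
  have : Group.IsNilpotent (actorExtension φ a) := (isPGroup_actorExtension φ hG ha).isNilpotent
  exact congrArg Subtype.val ((isPCentralIn_actorExtension φ hp hA a).pow_prime_pow_eq_one hp
    (z := ⟨z, Subgroup.mem_sup_left hz⟩) (x := ⟨x, hx⟩) hz (Subtype.ext hzx))

theorem pow_prime_pow_eq_one_iff (hp : p.Prime) (hG : IsPGroup p G)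
    (hA : ActsPCentrally φ p (gammaSeries φ p)) (hφ : Function.Injective φ) (n : ℕ) (a : A) :
    a ^ p ^ n = 1 ↔ ∀ g : G, (g⁻¹ * φ a g) ^ p ^ n = 1 := by
  have : Finite A := .of_injective φ hφ
  have hz (g : G) : SemidirectProduct.inl (g⁻¹ * φ a g) ∈ gammaSemidirect φ 2 :=
    inl_mem_gammaSemidirect_two φ (Subgroup.subset_closure ⟨g, a, rfl⟩)
  have hz_pow (g : G) : (SemidirectProduct.inl (g⁻¹ * φ a g) : G ⋊[φ] A) ^ p ^ n = 1 ↔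
      (g⁻¹ * φ a g) ^ p ^ n = 1 := by
    rw [← map_pow, ← map_one SemidirectProduct.inl, SemidirectProduct.inl_inj]
  constructor
  · intro ha g
    refine (hz_pow g).mp (pow_prime_pow_eq_one_of_mem_actorExtension φ hp hG hA ha (hz g)
      (inr_mem_actorExtension φ a) ((inl_mul_inr_pow_eq_iff φ a g _).mpr ?_))
    rw [ha, map_one, MulAut.one_apply]
  · intro h
    refine hφ (MulEquiv.ext fun g => ?_)
    rw [map_one, MulAut.one_apply]
    exact (inl_mul_inr_pow_eq_iff φ a g _).mp (mul_pow_prime_pow_eq_of_mem_actorExtension φ hp hG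
      hA (hz g) (inr_mem_actorExtension φ a) ((hz_pow g).mpr (h g)))

end Semidirect

end PCentral

theorem propositionP8 (p : ℕ) (hp : p.Prime) (G : Type*) [Group G] [Finite G]
    (hG : IsPGroup p G) (A : Subgroup (MulAut G))
    (hA : PCentral.ActsPCentrally A.subtype p (PCentral.gammaSeries A.subtype p))
    (n : ℕ) (σ : MulAut G) (hσ : σ ∈ A) :
    σ ^ p ^ n = 1 ↔
      PCentral.ActsTriviallyOnQuotient σ
        (PCentral.omega p n (PCentral.actionCommutator A.subtype)) := by
  have h := PCentral.pow_prime_pow_eq_one_iff A.subtype hp hG hA A.subtype_injective n ⟨σ, hσ⟩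
  rw [Subtype.ext_iff] at h
  refine h.trans (forall_congr' fun g => ?_)
  have hg : g⁻¹ * σ g ∈ PCentral.actionCommutator A.subtype :=
    Subgroup.subset_closure ⟨g, ⟨σ, hσ⟩, rfl⟩
  rw [@eq_comm (G ⧸ _), QuotientGroup.eq, PCentral.mem_omega_actionCommutator_iff _ hp hG hA,
    and_iff_right hg]
  rfl
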